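/- All groups are finite. The commuting graph $\Gamma(G)$ of a group $G$ has as its vertices the noncentral elements of $G$, two distinct vertices being adjacent if and only if they commute in $G$. An $A$-group is a group all of whose Sylow subgroups are abelian. A Frobenius group is a group $X$ having a Frobenius complement, that is, a subgroup $1 < H < X$ such that $H \cap gHg^{-1} = 1$ for all $g \in X \setminus H$; its Frobenius kernel is the subgroup consisting of $1$ and all elements of $X$ that lie in no conjugate of $H$. A 2-Frobenius group is a group $X$ with normal subgroups $K \le H$ such that $H$ is a Frobenius group with kernel $K$ and $X/K$ is a Frobenius group with kernel $H/K$. Let $p$ and $q$ be distinct primes and let $a, b \ge 0$ be integers. Let $G$ be a solvable nonabelian $A$-group of order $p^a q^b$ such that $G/Z(G)$ is neither a Frobenius group nor a 2-Frobenius group. Then $\Gamma(G)$ is connected and has diameter at most $4$. -/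

import Mathlib

/-- The commuting graph `Γ(G)`: its vertices are the noncentral elements of `G`, and two distinct
vertices are adjacent if and only if they commute in `G`. -/
def commutingGraph (G : Type*) [Group G] : SimpleGraph {x : G // x ∉ Subgroup.center G} where
  Adj x y := x ≠ y ∧ Commute (x : G) (y : G)
  symm := ⟨fun _ _ h => ⟨h.1.symm, h.2.symm⟩⟩
  loopless := ⟨fun _ h => h.1 rfl⟩

/-- An `A`-group (used for finite groups): every Sylow subgroup is abelian. -/
def IsAGroup (G : Type*) [Group G] : Prop :=
  ∀ (p : ℕ) (_ : p.Prime) (P : Sylow p G), ∀ x ∈ P, ∀ y ∈ P, x * y = y * x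

/-- `H` is a Frobenius complement in `G`: a nontrivial proper subgroup with
`H ∩ g H g⁻¹ = 1` for every `g ∉ H`. -/
def IsFrobeniusComplement {G : Type*} [Group G] (H : Subgroup G) : Prop :=
  H ≠ ⊥ ∧ H ≠ ⊤ ∧ ∀ g : G, g ∉ H → ∀ h ∈ H, g * h * g⁻¹ ∈ H → h = 1

/-- `G` is a Frobenius group (used for finite groups): it has a Frobenius complement. -/
def IsFrobeniusGroup (G : Type*) [Group G] : Prop :=
  ∃ H : Subgroup G, IsFrobeniusComplement H

/-- `G` is a Frobenius group with Frobenius kernel `K`: for some Frobenius complement `H`, the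
subgroup `K` consists of `1` and the elements that lie in no conjugate of `H`. -/
def IsFrobeniusGroupWithKernel {G : Type*} [Group G] (K : Subgroup G) : Prop :=
  ∃ H : Subgroup G, IsFrobeniusComplement H ∧
    ∀ x : G, x ∈ K ↔ x = 1 ∨ ∀ g : G, g * x * g⁻¹ ∉ H

/-- `X` is a 2-Frobenius group: it has normal subgroups `K ≤ H` such that `H` is a Frobenius group
with kernel `K`, and `X / K` is a Frobenius group with kernel `H / K`. -/
def IsTwoFrobeniusGroup (X : Type*) [Group X] : Prop :=
  ∃ (H K : Subgroup X) (_ : H.Normal) (_ : K.Normal), K ≤ H ∧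
    IsFrobeniusGroupWithKernel (K.subgroupOf H) ∧
    IsFrobeniusGroupWithKernel (H.map (QuotientGroup.mk' K))

/-! Let `N` be the derived subgroup. Transfer gives `N ∩ Z(G) = 1`, and two primes force `N` to be
abelian. A minimal supplement `C` of `N` is abelian, meets `N` trivially and contains `Z(G)`. As
`C/Z(G)` is not a Frobenius complement, some noncentral `c ∈ C` commutes with some `m ≠ 1` in `N`,
and then `m` commutes with every conjugate of `c`. An element `x` either commutes with some `n ≠ 1`
in `N`, or is conjugate into `C` and so commutes with a conjugate of `c`. Either way it is within
distance 2 of `m`, the common midpoint of all the paths. -/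

/-- In an `A`-group every subgroup of prime power order is abelian. -/
theorem IsAGroup.commute_of_isPGroup {G : Type*} [Group G] (hA : IsAGroup G) {r : ℕ}
    (hr : r.Prime) {R : Subgroup G} (hR : IsPGroup r R) {x y : G} (hx : x ∈ R) (hy : y ∈ R) :
    x * y = y * x := by
  obtain ⟨Q, hQ⟩ := hR.exists_le_sylow
  exact hA r hr Q x (hQ hx) y (hQ hy)

theorem IsAGroup.subgroup {G : Type*} [Group G] (hA : IsAGroup G) (H : Subgroup G) :
    IsAGroup H := by
  intro r hr P x hx y hy
  apply Subtype.ext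
  exact hA.commute_of_isPGroup hr (P.2.map H.subtype) (Subgroup.mem_map_of_mem _ hx)
    (Subgroup.mem_map_of_mem _ hy)

theorem IsAGroup.quotient {G : Type*} [Group G] [Finite G] (hA : IsAGroup G) (N : Subgroup G)
    [N.Normal] : IsAGroup (G ⧸ N) := by
  intro r hr P x hx y hy
  have : Fact r.Prime := ⟨hr⟩
  obtain ⟨Q, rfl⟩ := Sylow.mapSurjective_surjective (QuotientGroup.mk'_surjective N) r P
  obtain ⟨x, hx, rfl⟩ := hx
  obtain ⟨y, hy, rfl⟩ := hy
  rw [← map_mul, ← map_mul, hA r hr Q x hx y hy]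

/-- In a finite `A`-group the derived subgroup meets the center trivially. -/
theorem IsAGroup.commutator_inf_center {G : Type*} [Group G] [Finite G] (hA : IsAGroup G) :
    commutator G ⊓ Subgroup.center G = ⊥ := by
  rw [Subgroup.eq_bot_iff_card]
  by_contra hne
  obtain ⟨r, hr, hdvd⟩ := Nat.exists_prime_and_dvd hne
  have : Fact r.Prime := ⟨hr⟩
  obtain ⟨⟨z, hz', hz⟩, hord⟩ := exists_prime_orderOf_dvd_card' r hdvd
  rw [← Subgroup.orderOf_coe] at hord
  simp only at hord
  have hzP : IsPGroup r (Subgroup.zpowers z) := by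
    rw [IsPGroup.iff_card]
    exact ⟨1, by rw [Nat.card_zpowers, hord, pow_one]⟩
  obtain ⟨P, hP⟩ := hzP.exists_le_sylow
  have hzmem : z ∈ (P : Subgroup G) := hP (Subgroup.mem_zpowers z)
  let _ : CommGroup (P : Subgroup G) :=
    { (inferInstance : Group (P : Subgroup G)) with
      mul_comm := fun x y => Subtype.ext (hA r hr P x x.2 y y.2) }
  have key : ∀ (k : ℕ) (g₀ : G), g₀⁻¹ * z ^ k * g₀ ∈ (P : Subgroup G) →
      g₀⁻¹ * z ^ k * g₀ = z ^ k := by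
    intro k g₀ _
    rw [mul_assoc, ← Subgroup.mem_center_iff.1 (Subgroup.pow_mem _ hz k) g₀,
      inv_mul_cancel_left]
  -- Transfer into the abelian group `P` kills commutators but sends the central `z` to `z ^
  -- P.index`, and `r` does not divide that index.
  have h1 := MonoidHom.transfer_eq_pow (MonoidHom.id (P : Subgroup G)) z key
  have h2 : MonoidHom.transfer (MonoidHom.id (P : Subgroup G)) z = 1 :=
    Abelianization.commutator_subset_ker _ hz'
  rw [h2] at h1
  have h3 : z ^ (P : Subgroup G).index = 1 := (congrArg Subtype.val h1).symm
  have h4 := orderOf_dvd_of_pow_eq_one h3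
  rw [hord] at h4
  exact P.not_dvd_index h4

/-! ### Two primes: the derived subgroup is abelian -/

/-- Every nontrivial normal subgroup of a finite solvable group contains a nontrivial normal
subgroup of prime power order. -/
theorem Subgroup.exists_normal_isPGroup_le {G : Type*} [Group G] [Finite G]
    (hsol : Group.IsSolvable G) (B : Subgroup G) [hB : B.Normal] (hne : B ≠ ⊥) :
    ∃ (r : ℕ) (R : Subgroup G), r.Prime ∧ R.Normal ∧ R ≠ ⊥ ∧ R ≤ B ∧ IsPGroup r R ∧
      r ∣ Nat.card G := by
  obtain ⟨A, hAB, hmin⟩ := exists_minimal_le_of_wellFoundedLT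
    (fun A : Subgroup G => A.Normal ∧ A ≠ ⊥) B ⟨hB, hne⟩
  obtain ⟨hAn, hA0⟩ := hmin.1
  have hlt := Group.IsSolvable.commutator_lt_of_ne_bot hA0
  have hAA : ⁅A, A⁆ = ⊥ := by
    by_contra h
    exact hlt.not_ge (hmin.2 ⟨inferInstance, h⟩ hlt.le)
  have hcomm : IsMulCommutative A := by
    refine ⟨⟨fun x y => Subtype.ext ?_⟩⟩
    have := Subgroup.commutator_mem_commutator x.2 y.2
    rw [hAA, Subgroup.mem_bot, commutatorElement_eq_one_iff_mul_comm] at this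
    exact this
  obtain ⟨r, hr, hdvd⟩ := Nat.exists_prime_and_dvd (mt (Subgroup.eq_bot_of_card_eq A) hA0)
  have : Fact r.Prime := ⟨hr⟩
  let S : Sylow r A := default
  have hSn : (S : Subgroup A).Normal := inferInstance
  have hSc := S.characteristic_of_normal hSn
  refine ⟨r, (S : Subgroup A).map A.subtype, hr, inferInstance, ?_,
    (Subgroup.map_subtype_le _).trans hAB, S.2.map _, hdvd.trans A.card_subgroup_dvd_card⟩
  rw [Ne, Subgroup.map_eq_bot_iff_of_injective _ A.subtype_injective]
  exact S.ne_bot_of_dvd_card hdvd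

/-- If a finite solvable `A`-group of order divisible by no primes other than `p` and `q` has no
nontrivial normal `q`-subgroup, then it is metabelian. -/
theorem IsAGroup.derivedSeries_two_eq_bot_of_core {G : Type*} [Group G] [Finite G]
    (hA : IsAGroup G) (hsol : Group.IsSolvable G) {p q : ℕ} (hp : p.Prime) (hq : q.Prime)
    (hpr : ∀ r : ℕ, r.Prime → r ∣ Nat.card G → r = p ∨ r = q)
    (hcore : ∀ N : Subgroup G, N.Normal → IsPGroup q N → N = ⊥) :
    derivedSeries G 2 = ⊥ := by
  have : Fact p.Prime := ⟨hp⟩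
  let P : Sylow p G := default
  set M := (P : Subgroup G).normalCore with hM
  set K := Subgroup.centralizer (M : Set G) with hK
  have hKn : K.Normal := inferInstance
  have hPK : (P : Subgroup G) ≤ K := by
    intro x hx
    rw [hK, Subgroup.mem_centralizer_iff]
    intro m hm
    exact hA p hp P m (Subgroup.normalCore_le _ hm) x hx
  -- A normal `p`-subgroup in `K'` lies in `M`, which `K` centralizes, hence in `K' ∩ Z(K) = 1`.
  have hKK : ⁅K, K⁆ = ⊥ := by
    by_contra hne
    obtain ⟨r, R, hr, hRn, hR0, hRK, hRr, hrG⟩ :=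
      Subgroup.exists_normal_isPGroup_le hsol ⁅K, K⁆ hne
    rcases hpr r hr hrG with rfl | rfl
    · apply hR0
      have hRM : R ≤ M := Subgroup.normal_le_normalCore.2 (hRr.le_sylow_of_normal P)
      rw [Subgroup.eq_bot_iff_forall]
      intro x hx
      have hxK : x ∈ K := Subgroup.commutator_le_self K (hRK hx)
      have hx1 : (⟨x, hxK⟩ : K) ∈ commutator K ⊓ Subgroup.center K := by
        constructor
        · have := hRK hx
          rw [← K.map_subtype_commutator] at this
          obtain ⟨y, hy, hyx⟩ := this
          have : y = ⟨x, hxK⟩ := Subtype.ext hyx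
          exact this ▸ hy
        · refine Subgroup.mem_center_iff.2 fun k => ?_
          exact Subtype.ext ((Subgroup.mem_centralizer_iff.1 k.2 x (hRM hx)).symm)
      rw [(hA.subgroup K).commutator_inf_center, Subgroup.mem_bot] at hx1
      exact congrArg Subtype.val hx1
    · exact hR0 (hcore R hRn hRr)
  -- `P` is a Sylow subgroup of the abelian normal `K`, so characteristic in it.
  have hPn : (P : Subgroup G).Normal := by
    have hcomm : IsMulCommutative K := by
      refine ⟨⟨fun x y => Subtype.ext ?_⟩⟩
      have := Subgroup.commutator_mem_commutator x.2 y.2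
      rw [hKK, Subgroup.mem_bot, commutatorElement_eq_one_iff_mul_comm] at this
      exact this
    have hn : ((P.subtype hPK : Sylow p K) : Subgroup K).Normal := inferInstance
    have hc := (P.subtype hPK).characteristic_of_normal hn
    have h : (((P.subtype hPK : Sylow p K) : Subgroup K).map K.subtype).Normal := inferInstance
    rwa [Sylow.coe_subtype, Subgroup.subgroupOf_map_subtype, inf_eq_left.2 hPK] at h
  have hquot : IsPGroup q (⊤ : Subgroup (G ⧸ (P : Subgroup G))) := by
    have hq' : Fact q.Prime := ⟨hq⟩
    rw [IsPGroup.iff_card, Subgroup.card_top]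
    refine ⟨_, Nat.eq_prime_pow_of_unique_prime_dvd Nat.card_pos.ne' fun {d} hd hdvd => ?_⟩
    rcases hpr d hd (hdvd.trans (Subgroup.card_quotient_dvd_card _)) with rfl | rfl
    · exact absurd hdvd P.not_dvd_index
    · rfl
  have hle : commutator G ≤ P := by
    rw [commutator_def, Subgroup.commutator_le]
    intro x _ y _
    rw [← QuotientGroup.eq_one_iff, ← QuotientGroup.mk'_apply, map_commutatorElement,
      commutatorElement_eq_one_iff_mul_comm]
    exact (hA.quotient _).commute_of_isPGroup hq hquot (Subgroup.mem_top _) (Subgroup.mem_top _)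
  rw [derivedSeries_succ, derivedSeries_one, Subgroup.commutator_eq_bot_iff_le_centralizer]
  intro x hx
  rw [Subgroup.mem_centralizer_iff]
  intro y hy
  exact hA p hp P y (hle hy) x (hle hx)

/-- A finite solvable `A`-group whose order is divisible by at most two primes is metabelian. -/
theorem IsAGroup.derivedSeries_two_eq_bot {p q : ℕ} (hp : p.Prime) (hq : q.Prime) (hpq : p ≠ q)
    (n : ℕ) : ∀ (G : Type*) [Group G] [Finite G], Nat.card G = n → IsAGroup G →
    Group.IsSolvable G → (∀ r : ℕ, r.Prime → r ∣ Nat.card G → r = p ∨ r = q) →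
    derivedSeries G 2 = ⊥ := by
  induction n using Nat.strong_induction_on with
  | _ n ih =>
  intro G _ _ hn hA hsol hpr
  have quot : ∀ N : Subgroup G, N.Normal → N ≠ ⊥ → derivedSeries G 2 ≤ N := by
    intro N hN hne
    have hlt : Nat.card (G ⧸ N) < n := by
      rw [← hn, N.card_eq_card_quotient_mul_card_subgroup]
      exact lt_mul_of_one_lt_right Nat.card_pos ((Subgroup.one_lt_card_iff_ne_bot N).2 hne)
    have h := ih _ hlt (G ⧸ N) rfl (hA.quotient N) inferInstance
      fun r hr hd => hpr r hr (hd.trans N.card_quotient_dvd_card)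
    rw [← map_derivedSeries_eq (QuotientGroup.mk'_surjective N), Subgroup.map_eq_bot_iff,
      QuotientGroup.ker_mk'] at h
    exact h
  by_cases h1 : ∀ N : Subgroup G, N.Normal → IsPGroup q N → N = ⊥
  · exact hA.derivedSeries_two_eq_bot_of_core hsol hp hq hpr h1
  by_cases h2 : ∀ N : Subgroup G, N.Normal → IsPGroup p N → N = ⊥
  · exact hA.derivedSeries_two_eq_bot_of_core hsol hq hp (fun r hr h => (hpr r hr h).symm) h2
  push Not at h1 h2
  obtain ⟨N₁, hN₁, hq₁, hne₁⟩ := h1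
  obtain ⟨N₂, hN₂, hp₂, hne₂⟩ := h2
  have : Fact p.Prime := ⟨hp⟩
  have : Fact q.Prime := ⟨hq⟩
  -- With both cores nontrivial, induction on the quotients puts `G''` in a `p`-group and in a
  -- `q`-group.
  exact le_bot_iff.1 ((IsPGroup.disjoint_of_ne p q hpq N₂ N₁ hp₂ hq₁) (quot N₂ hN₂ hne₂)
    (quot N₁ hN₁ hne₁))

/-! ### Abelian supplement of the derived subgroup -/

/-- A finite nilpotent `A`-group is abelian. -/
theorem IsAGroup.mul_comm_of_isNilpotent {G : Type*} [Group G] [Finite G] (hA : IsAGroup G)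
    (hG : Group.IsNilpotent G) (x y : G) : x * y = y * x := by
  obtain ⟨e⟩ := ((Group.isNilpotent_of_finite_tfae (G := G)).out 0 4).mp hG
  rw [← e.symm.injective.eq_iff, map_mul, map_mul]
  funext r P
  exact Subtype.ext (hA r (Nat.prime_of_mem_primeFactors r.2) P _ (e.symm x r P).2 _
    (e.symm y r P).2)

/-- In a finite `A`-group the derived subgroup has an abelian supplement. -/
theorem IsAGroup.exists_abelian_supplement {G : Type*} [Group G] [Finite G] (hA : IsAGroup G) :
    ∃ C : Subgroup G, commutator G ⊔ C = ⊤ ∧ ∀ x ∈ C, ∀ y ∈ C, x * y = y * x := by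
  obtain ⟨C, -, hmin⟩ := exists_minimal_le_of_wellFoundedLT
    (fun C : Subgroup G => commutator G ⊔ C = ⊤) ⊤ (sup_top_eq _)
  refine ⟨C, hmin.1, fun x hx y hy => ?_⟩
  have hnil : Group.IsNilpotent C := by
    refine ((Group.isNilpotent_of_finite_tfae (G := C)).out 0 2).mpr fun H hH => ?_
    -- A maximal `H` missing part of `C'` would be a smaller supplement, since `C = H C'` and `C' ≤
    -- G'`.
    suffices hle : commutator C ≤ H from Subgroup.Normal.of_commutator_le _ hle
    by_contra hnle
    have htop : H ⊔ commutator C = ⊤ := hH.2 _ (left_lt_sup.2 hnle)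
    have hmap : H.map C.subtype ⊔ (commutator C).map C.subtype = C := by
      rw [← Subgroup.map_sup, htop, ← MonoidHom.range_eq_map, C.range_subtype]
    have hsup : commutator G ⊔ H.map C.subtype = ⊤ := by
      rw [eq_top_iff, ← hmin.1]
      refine sup_le le_sup_left ?_
      nth_rewrite 1 [← hmap]
      refine sup_le le_sup_right (le_trans ?_ le_sup_left)
      rw [C.map_subtype_commutator]
      exact Subgroup.commutator_mono le_top le_top
    have hC := hmin.2 hsup (Subgroup.map_subtype_le H)
    apply hH.1
    rw [eq_top_iff]
    intro c _
    obtain ⟨h, hh, hc⟩ := hC c.2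
    have : h = c := Subtype.ext hc
    exact this ▸ hh
  exact congrArg Subtype.val ((hA.subgroup C).mul_comm_of_isNilpotent hnil ⟨x, hx⟩ ⟨y, hy⟩)

/-- Allowing `x = y` lets paths be concatenated without checking that their vertices are distinct.
-/
theorem commutingGraph.edist_le_one {G : Type*} [Group G] {x y : {x : G // x ∉ Subgroup.center G}}
    (h : Commute (x : G) y) : (commutingGraph G).edist x y ≤ 1 := by
  rcases eq_or_ne x y with rfl | hne
  · simp
  · have hadj : (commutingGraph G).Adj x y := ⟨hne, h⟩
    exact (SimpleGraph.edist_eq_one_iff_adj.2 hadj).le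

theorem commutingGraph.edist_le_four {G : Type*} [Group G]
    {x y : {x : G // x ∉ Subgroup.center G}} {u v w : G} (hu : u ∉ Subgroup.center G)
    (hv : v ∉ Subgroup.center G) (hw : w ∉ Subgroup.center G) (hxu : Commute (x : G) u)
    (huv : Commute u v) (hvw : Commute v w) (hwy : Commute w (y : G)) :
    (commutingGraph G).edist x y ≤ 4 := by
  have h1 := edist_le_one (x := x) (y := ⟨u, hu⟩) hxu
  have h2 := edist_le_one (x := ⟨u, hu⟩) (y := ⟨v, hv⟩) huv
  have h3 := edist_le_one (x := ⟨v, hv⟩) (y := ⟨w, hw⟩) hvw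
  have h4 := edist_le_one (x := ⟨w, hw⟩) (y := y) hwy
  calc (commutingGraph G).edist x y ≤ 1 + (1 + (1 + 1)) :=
        SimpleGraph.edist_triangle.trans (add_le_add h1 (SimpleGraph.edist_triangle.trans
          (add_le_add h2 (SimpleGraph.edist_triangle.trans (add_le_add h3 h4)))))
    _ = 4 := by norm_num

/-! ### Abelian normal `N` with abelian supplement `C` -/

section AbelianByAbelian

variable {G : Type*} [Group G] {N C : Subgroup G} [N.Normal]

theorem inf_eq_bot_of_inf_center_eq_bot (hN : ∀ x ∈ N, ∀ y ∈ N, x * y = y * x)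
    (hC : ∀ x ∈ C, ∀ y ∈ C, x * y = y * x) (hNC : N ⊔ C = ⊤)
    (hZ : N ⊓ Subgroup.center G = ⊥) : N ⊓ C = ⊥ := by
  rw [eq_bot_iff, ← hZ]
  refine fun x hx => ⟨hx.1, Subgroup.mem_center_iff.2 fun g => ?_⟩
  obtain ⟨n, hn, c, hc, rfl⟩ := Subgroup.mem_sup_of_normal_left.1 (hNC ▸ Subgroup.mem_top g)
  rw [mul_assoc, hC c hc x hx.2, ← mul_assoc, hN n hn x hx.1, mul_assoc]

/-- The `N`-part of a central element commutes with both `C` and `N`, so it is central. -/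
theorem center_le_of_inf_center_eq_bot (hN : ∀ x ∈ N, ∀ y ∈ N, x * y = y * x)
    (hC : ∀ x ∈ C, ∀ y ∈ C, x * y = y * x) (hNC : N ⊔ C = ⊤)
    (hZ : N ⊓ Subgroup.center G = ⊥) : Subgroup.center G ≤ C := by
  intro z hz
  obtain ⟨n, hn, c, hc, rfl⟩ := Subgroup.mem_sup_of_normal_left.1 (hNC ▸ Subgroup.mem_top z)
  suffices n ∈ N ⊓ Subgroup.center G by
    rw [hZ, Subgroup.mem_bot] at this
    rwa [this, one_mul]
  have hnC : ∀ d ∈ C, d * n = n * d := by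
    intro d hd
    have h := Subgroup.mem_center_iff.1 hz d
    rw [mul_assoc n c d, hC c hc d hd, ← mul_assoc, ← mul_assoc] at h
    exact mul_right_cancel h
  refine ⟨hn, Subgroup.mem_center_iff.2 fun g => ?_⟩
  obtain ⟨m, hm, d, hd, rfl⟩ := Subgroup.mem_sup_of_normal_left.1 (hNC ▸ Subgroup.mem_top g)
  rw [mul_assoc, hnC d hd, ← mul_assoc, hN m hm n hn, mul_assoc]

/-- If `G / Z(G)` is not a Frobenius group, then some noncentral element of the abelian
supplement `C` commutes with a nontrivial element of `N`. -/
theorem exists_commute_of_not_isFrobeniusGroup (hN : ∀ x ∈ N, ∀ y ∈ N, x * y = y * x)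
    (hC : ∀ x ∈ C, ∀ y ∈ C, x * y = y * x) (hNC : N ⊔ C = ⊤)
    (hZ : N ⊓ Subgroup.center G = ⊥) (hnonab : ¬ ∀ x y : G, x * y = y * x)
    (hF : ¬ IsFrobeniusGroup (G ⧸ Subgroup.center G)) :
    ∃ c ∈ C, c ∉ Subgroup.center G ∧ ∃ n ∈ N, n ≠ 1 ∧ Commute n c := by
  by_contra! hcon
  have hZC := center_le_of_inf_center_eq_bot hN hC hNC hZ
  have hinf := inf_eq_bot_of_inf_center_eq_bot hN hC hNC hZ
  have hmem : ∀ g : G, QuotientGroup.mk' (Subgroup.center G) g ∈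
      C.map (QuotientGroup.mk' (Subgroup.center G)) ↔ g ∈ C := by
    intro g
    rw [← Subgroup.mem_comap, Subgroup.comap_map_eq, QuotientGroup.ker_mk', sup_eq_left.2 hZC]
  refine hF ⟨C.map (QuotientGroup.mk' _), ?_, ?_, ?_⟩
  · intro h
    rw [Subgroup.map_eq_bot_iff, QuotientGroup.ker_mk'] at h
    refine hnonab fun x y => ?_
    obtain ⟨n, hn, c, hc, rfl⟩ := Subgroup.mem_sup_of_normal_left.1 (hNC ▸ Subgroup.mem_top x)
    obtain ⟨m, hm, d, hd, rfl⟩ := Subgroup.mem_sup_of_normal_left.1 (hNC ▸ Subgroup.mem_top y)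
    have hc := Subgroup.mem_center_iff.1 (h hc)
    have hd := Subgroup.mem_center_iff.1 (h hd)
    calc n * c * (m * d) = n * (m * d * c) := by rw [mul_assoc, hc (m * d)]
      _ = n * m * d * c := by group
      _ = m * n * d * c := by rw [hN n hn m hm]
      _ = m * (n * d) * c := by group
      _ = m * d * (n * c) := by rw [hd n]; group
  · intro h
    refine hnonab fun x y => hC x ?_ y ?_ <;>
    · rw [← hmem, h]
      exact Subgroup.mem_top _
  · intro g hg h hh hgh
    obtain ⟨g, rfl⟩ := QuotientGroup.mk'_surjective _ g
    obtain ⟨h, hh, rfl⟩ := hh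
    rw [hmem] at hg
    rw [← map_inv, ← map_mul, ← map_mul, hmem] at hgh
    by_contra hne
    have hhZ : h ∉ Subgroup.center G := fun hz => hne ((QuotientGroup.eq_one_iff h).2 hz)
    obtain ⟨n, hn, c, hc, rfl⟩ := Subgroup.mem_sup_of_normal_left.1 (hNC ▸ Subgroup.mem_top g)
    have hn1 : n ≠ 1 := by
      rintro rfl
      exact hg (by rwa [one_mul])
    have hconj : n * c * h * (n * c)⁻¹ = n * h * n⁻¹ := by
      rw [mul_assoc n c h, hC c hc h hh]; group
    rw [hconj] at hgh
    -- The commutator of `n` and `h` lies in `N ∩ C = 1`.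
    have hN' : n * h * n⁻¹ * h⁻¹ ∈ N := by
      rw [mul_assoc, mul_assoc, ← mul_assoc h]
      exact N.mul_mem hn (Subgroup.Normal.conj_mem inferInstance _ (N.inv_mem hn) h)
    have h1 : n * h * n⁻¹ * h⁻¹ ∈ N ⊓ C := ⟨hN', C.mul_mem hgh (C.inv_mem hh)⟩
    rw [hinf, Subgroup.mem_bot, mul_inv_eq_one, mul_inv_eq_iff_eq_mul] at h1
    exact hcon h hh hhZ n hn hn1 h1

/-- An element commuting with no nontrivial element of `N` is conjugate into `C`. -/
theorem exists_conj_mem_of_forall_not_commute [Finite G]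
    (hNC : N ⊔ C = ⊤) {x : G} (hx : ∀ n ∈ N, Commute x n → n = 1) :
    ∃ g : G, g * x * g⁻¹ ∈ C := by
  obtain ⟨n, hn, c, hc, rfl⟩ := Subgroup.mem_sup_of_normal_left.1 (hNC ▸ Subgroup.mem_top x)
  have hconj : ∀ m : N, (n * c) * (m : G)⁻¹ * (n * c)⁻¹ ∈ N := fun m =>
    Subgroup.Normal.conj_mem inferInstance _ (N.inv_mem m.2) _
  -- With `x = n * c`, `f m` is the commutator of `m` and `x`. It is injective because `x`
  -- centralizes no nontrivial element of `N`, so by finiteness it takes the value `n⁻¹`, and that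
  -- `m` conjugates `x` to `c`.
  let f : N → N := fun m => ⟨m * ((n * c) * (m : G)⁻¹ * (n * c)⁻¹), N.mul_mem m.2 (hconj m)⟩
  have hinj : Function.Injective f := by
    intro m m' h
    have h' : (m : G) * ((n * c) * (m : G)⁻¹ * (n * c)⁻¹) =
        m' * ((n * c) * (m' : G)⁻¹ * (n * c)⁻¹) := congrArg Subtype.val h
    have h2 : (m' : G)⁻¹ * m = 1 := by
      refine hx _ (N.mul_mem (N.inv_mem m'.2) m.2) ?_
      have h3 : (m' : G)⁻¹ * m = (n * c) * (m' : G)⁻¹ * (n * c)⁻¹ *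
          ((n * c) * (m : G)⁻¹ * (n * c)⁻¹)⁻¹ := by
        rw [eq_mul_inv_iff_mul_eq, mul_assoc, h', inv_mul_cancel_left]
      have h4 : (m' : G)⁻¹ * m = (n * c) * ((m' : G)⁻¹ * m) * (n * c)⁻¹ := by
        nth_rewrite 1 [h3]
        group
      exact (mul_inv_eq_iff_eq_mul.1 h4.symm)
    exact Subtype.ext (inv_mul_eq_one.1 h2).symm
  obtain ⟨m, hm⟩ := (Finite.injective_iff_surjective.1 hinj) ⟨n⁻¹, N.inv_mem hn⟩
  have hm' : (m : G) * ((n * c) * (m : G)⁻¹ * (n * c)⁻¹) = n⁻¹ := congrArg Subtype.val hm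
  refine ⟨m, ?_⟩
  have h5 : (m : G) * (n * c) * (m : G)⁻¹ = c := by
    calc (m : G) * (n * c) * (m : G)⁻¹
        = m * ((n * c) * (m : G)⁻¹ * (n * c)⁻¹) * (n * c) := by group
      _ = c := by rw [hm', inv_mul_cancel_left]
  rwa [h5]

/-- The elements of `N` commuting with a given `c ∈ C` commute with all conjugates of `c`. -/
theorem commute_conj_of_commute (hN : ∀ x ∈ N, ∀ y ∈ N, x * y = y * x)
    (hC : ∀ x ∈ C, ∀ y ∈ C, x * y = y * x) (hNC : N ⊔ C = ⊤) {m c : G} (hm : m ∈ N) (hc : c ∈ C)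
    (hmc : Commute m c) (g : G) : Commute m (g * c * g⁻¹) := by
  obtain ⟨n, hn, d, hd, rfl⟩ := Subgroup.mem_sup_of_normal_left.1 (hNC ▸ Subgroup.mem_top g)
  have h : n * d * c * (n * d)⁻¹ = n * c * n⁻¹ := by
    rw [mul_assoc n d c, hC d hd c hc]; group
  have hmn : Commute m n := hN m hm n hn
  rw [h]
  exact (hmn.mul_right hmc).mul_right hmn.inv_right

theorem commutingGraph.edist_le_four_of_abelian_supplement [Finite G]
    (hN : ∀ x ∈ N, ∀ y ∈ N, x * y = y * x)
    (hC : ∀ x ∈ C, ∀ y ∈ C, x * y = y * x) (hNC : N ⊔ C = ⊤)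
    (hZ : N ⊓ Subgroup.center G = ⊥) (hnonab : ¬ ∀ x y : G, x * y = y * x)
    (hF : ¬ IsFrobeniusGroup (G ⧸ Subgroup.center G))
    (x y : {x : G // x ∉ Subgroup.center G}) : (commutingGraph G).edist x y ≤ 4 := by
  obtain ⟨c, hc, hcZ, m, hm, hm1, hmc⟩ :=
    exists_commute_of_not_isFrobeniusGroup hN hC hNC hZ hnonab hF
  have hNZ : ∀ n ∈ N, n ≠ 1 → n ∉ Subgroup.center G := by
    intro n hn hn1 hz
    have : n ∈ N ⊓ Subgroup.center G := ⟨hn, hz⟩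
    rw [hZ] at this
    exact hn1 this
  have key : ∀ x : G, ∃ u : G, u ∉ Subgroup.center G ∧ Commute x u ∧ Commute u m := by
    intro x
    by_cases h : ∀ n ∈ N, Commute x n → n = 1
    · obtain ⟨g, hg⟩ := exists_conj_mem_of_forall_not_commute hNC h
      refine ⟨g⁻¹ * c * g⁻¹⁻¹, fun hz => hcZ ?_, ?_,
        (commute_conj_of_commute hN hC hNC hm hc hmc g⁻¹).symm⟩
      · have := Subgroup.Normal.conj_mem inferInstance _ hz g
        simpa [mul_assoc] using this
      · have h1 : Commute (g * x * g⁻¹) c := hC _ hg c hc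
        have h2 := h1.conj (h := g⁻¹)
        simpa [mul_assoc] using h2
    · push Not at h
      obtain ⟨n, hn, hxn, hn1⟩ := h
      exact ⟨n, hNZ n hn hn1, hxn, hN n hn m hm⟩
  obtain ⟨u, hu, hxu, hum⟩ := key x
  obtain ⟨w, hw, hyw, hwm⟩ := key y
  exact edist_le_four hu (hNZ m hm hm1) hw hxu hum hwm.symm hyw.symm

end AbelianByAbelian

theorem corollary3p4 {G : Type*} [Group G] [Finite G]
    (p q a b : ℕ) (hp : p.Prime) (hq : q.Prime) (hpq : p ≠ q)
    (hsol : Group.IsSolvable G) (hcard : Nat.card G = p ^ a * q ^ b)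
    (hA : IsAGroup G)
    (hnonab : ¬ ∀ x y : G, x * y = y * x)
    (hF : ¬ IsFrobeniusGroup (G ⧸ Subgroup.center G))
    (h2F : ¬ IsTwoFrobeniusGroup (G ⧸ Subgroup.center G)) :
    (commutingGraph G).Connected ∧ (commutingGraph G).ediam ≤ 4 := by
  have hpr : ∀ r : ℕ, r.Prime → r ∣ Nat.card G → r = p ∨ r = q := by
    intro r hr hd
    rw [hcard, hr.dvd_mul] at hd
    exact hd.imp (fun h => (Nat.prime_dvd_prime_iff_eq hr hp).1 (hr.dvd_of_dvd_pow h))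
      (fun h => (Nat.prime_dvd_prime_iff_eq hr hq).1 (hr.dvd_of_dvd_pow h))
  have hder := IsAGroup.derivedSeries_two_eq_bot hp hq hpq _ G rfl hA hsol hpr
  rw [derivedSeries_succ, derivedSeries_one,
    Subgroup.commutator_eq_bot_iff_le_centralizer] at hder
  obtain ⟨C, hNC, hC⟩ := hA.exists_abelian_supplement
  have hdist := commutingGraph.edist_le_four_of_abelian_supplement (N := commutator G)
    (fun x hx y hy => Subgroup.mem_centralizer_iff.1 (hder hy) x hx) hC hNC
    hA.commutator_inf_center hnonab hF
  refine ⟨?_, SimpleGraph.ediam_le_of_edist_le hdist⟩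
  rw [SimpleGraph.connected_iff]
  refine ⟨fun x y => SimpleGraph.reachable_of_edist_ne_top
    (ne_top_of_le_ne_top (by decide) (hdist x y)), ?_⟩
  push Not at hnonab
  obtain ⟨x, y, hxy⟩ := hnonab
  exact ⟨x, fun hx => hxy (Subgroup.mem_center_iff.1 hx y).symm⟩
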